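/- Let $n\ge 2$ be an integer and let $\mathcal O_n$ be the Cuntz algebra, i.e. the universal unital $C^*$-algebra generated by isometries $S_1,\dots,S_n$ with $\sum_{i=1}^n S_iS_i^*=1$. For $k\ge 0$ let $W_n^k=\{1,\dots,n\}^k$, and for $\alpha=(\alpha_1,\dots,\alpha_k)\in W_n^k$ put $S_\alpha=S_{\alpha_1}\cdots S_{\alpha_k}$ (with $S_\alpha=1$ if $k=0$). Let $\mathcal F_n^k=\operatorname{span}\{S_\alpha S_\beta^*:\alpha,\beta\in W_n^k\}$. For a unitary $u\in\mathcal O_n$ let $\lambda_u$ be the unique unital $*$-endomorphism of $\mathcal O_n$ with $\lambda_u(S_i)=uS_i$ for $i=1,\dots,n$. The Bogolyubov automorphisms of $\mathcal O_n$ are the maps $\lambda_z$ with $z$ a unitary in $\mathcal F_n^1$. A permutation $\sigma$ of $W_n^k$ is called induced if there is a permutation $\omega$ of $\{1,\dots,k\}$ such that $\sigma(\alpha)=(\alpha_{\omega(1)},\dots,\alpha_{\omega(k)})$ for all $\alpha\in W_n^k$; the permutation unitary associated with $\sigma$ is $\sum_{\alpha\in W_n^k}S_{\sigma(\alpha)}S_\alpha^*$.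 Let $k\ge 0$ and let $u$ be a unitary in $\mathcal F_n^k$. Then $\lambda_u$ commutes with all Bogolyubov automorphisms of $\mathcal O_n$ if and only if $u$ is a (complex) linear combination of permutation unitaries associated with induced permutations of $W_n^k$. -/

import Mathlib

noncomputable section

namespace Cuntz

open scoped ENNReal CStarAlgebra

/-- A Cuntz family in a unital star ring: isometries `s 0, …, s (n - 1)` whose range projections
sum to the identity. -/
def IsCuntzFamily {A : Type*} [Ring A] [StarRing A] {n : ℕ} (s : Fin n → A) : Prop :=
  (∀ i, star (s i) * s i = 1) ∧ ∑ i, s i * star (s i) = 1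

theorem IsCuntzFamily.unitary_mul {A : Type*} [Ring A] [StarRing A] {n : ℕ} {s : Fin n → A}
    (hs : IsCuntzFamily s) {u : A} (hu : u ∈ unitary A) : IsCuntzFamily (fun i => u * s i) := by
  refine ⟨fun i => ?_, ?_⟩
  · rw [star_mul, mul_assoc, ← mul_assoc (star u), Unitary.star_mul_self_of_mem hu, one_mul, hs.1]
  · have : ∀ i, u * s i * star (u * s i) = u * (s i * star (s i)) * star u := fun i => by
      rw [star_mul]; simp only [mul_assoc]
    simp only [this]
    rw [← Finset.sum_mul, ← Finset.mul_sum, hs.2, mul_one, Unitary.mul_star_self_of_mem hu]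

/-- The separable infinite-dimensional Hilbert space `ℓ²(ℕ)`. -/
abbrev EllTwo : Type := lp (fun _ : ℕ => ℂ) 2

instance : Nontrivial EllTwo :=
  ⟨⟨lp.single 2 0 (1 : ℂ), 0, fun h => by
    have := congrArg (fun x : EllTwo => x 0) h
    simp at this⟩⟩

/-- The representations of the Cuntz relations on `ℓ²(ℕ)`: all families of `n` isometries of
`ℓ²(ℕ)` whose range projections sum to the identity (the star is the Hilbert space adjoint). -/
def Rep (n : ℕ) : Type := {s : Fin n → (EllTwo →L[ℂ] EllTwo) // IsCuntzFamily s}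

/-- The `ℓ^∞`-direct product, over all representations `π` of the Cuntz relations, of the
C⋆-algebras `B(ℓ²(ℕ))`. -/
abbrev RepProd (n : ℕ) : Type := lp (fun _ : Rep n => EllTwo →L[ℂ] EllTwo) ∞

instance (n : ℕ) : CStarAlgebra (RepProd n) where

theorem norm_le_one_of_isometry {A : Type*} [CStarAlgebra A] {a : A} (ha : star a * a = 1) :
    ‖a‖ ≤ 1 := by
  have h1 : ‖a‖ * ‖a‖ = ‖(1 : A)‖ := by rw [← CStarRing.norm_star_mul_self, ha]
  rcases subsingleton_or_nontrivial A with h | h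
  · rw [Subsingleton.elim a 0, norm_zero]; exact zero_le_one
  · rw [CStarRing.norm_one] at h1
    nlinarith [norm_nonneg a]

/-- The direct sum over all representations `π` of the isometries `π i`. -/
def univGen (n : ℕ) (i : Fin n) : RepProd n :=
  ⟨fun π => π.1 i, memℓp_infty ⟨1, by
    rintro _ ⟨π, rfl⟩
    exact norm_le_one_of_isometry (π.2.1 i)⟩⟩

theorem isCuntzFamily_univGen (n : ℕ) : IsCuntzFamily (univGen n) := by
  refine ⟨fun i => ?_, ?_⟩
  · ext1; funext π; exact π.2.1 i
  · ext1; funext π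
    rw [lp.coeFn_sum, Finset.sum_apply]
    exact π.2.2

/-- The norm-closed unital star subalgebra generated by the direct sum of all representations. -/
def cuntzSubalgebra (n : ℕ) : StarSubalgebra ℂ (RepProd n) :=
  (StarAlgebra.adjoin ℂ (Set.range (univGen n))).topologicalClosure

theorem isClosed_cuntzSubalgebra (n : ℕ) : IsClosed (cuntzSubalgebra n : Set (RepProd n)) :=
  StarSubalgebra.isClosed_topologicalClosure _

/-- The Cuntz algebra `𝒪_n`: the universal unital C⋆-algebra generated by `n` isometries whose
range projections sum to `1`, realised as the closed star algebra generated by the direct sum of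
all representations of these relations on `ℓ²(ℕ)`. For `n ≥ 2` every nonzero C⋆-algebra generated
by such isometries is isomorphic to it, by Cuntz's uniqueness theorem. -/
def CuntzAlgebra (n : ℕ) : Type := cuntzSubalgebra n

instance (n : ℕ) : CStarAlgebra (CuntzAlgebra n) :=
  have : IsClosed (cuntzSubalgebra n : Set (RepProd n)) := isClosed_cuntzSubalgebra n
  inferInstanceAs (CStarAlgebra (cuntzSubalgebra n))

/-- The inclusion of `𝒪_n` into the direct product of all representations. -/
def incl (n : ℕ) : CuntzAlgebra n →⋆ₐ[ℂ] RepProd n := (cuntzSubalgebra n).subtype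

/-- The canonical generating isometries `S_i` of `𝒪_n`. -/
def S {n : ℕ} (i : Fin n) : CuntzAlgebra n :=
  ⟨univGen n i, StarSubalgebra.le_topologicalClosure _
    (StarAlgebra.subset_adjoin ℂ _ ⟨i, rfl⟩)⟩

theorem incl_injective (n : ℕ) : Function.Injective (incl n) := Subtype.val_injective

theorem incl_S {n : ℕ} (i : Fin n) : incl n (S i) = univGen n i := rfl

theorem isCuntzFamily_S (n : ℕ) : IsCuntzFamily (S : Fin n → CuntzAlgebra n) := by
  refine ⟨fun i => incl_injective n ?_, incl_injective n ?_⟩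
  · simpa only [map_mul, map_star, map_one, incl_S] using (isCuntzFamily_univGen n).1 i
  · simpa only [map_sum, map_mul, map_star, map_one, incl_S] using (isCuntzFamily_univGen n).2

/-- Pulling back along a self-map of the set of representations. -/
def reindex {n : ℕ} (τ : Rep n → Rep n) : RepProd n →⋆ₐ[ℂ] RepProd n where
  toFun x := ⟨fun π => x (τ π), memℓp_infty ⟨‖x‖, by
    rintro _ ⟨π, rfl⟩
    exact lp.norm_apply_le_norm ENNReal.top_ne_zero x (τ π)⟩⟩
  map_one' := rfl
  map_mul' _ _ := rfl
  map_zero' := rfl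
  map_add' _ _ := rfl
  commutes' _ := rfl
  map_star' _ := rfl

/-- A unital star endomorphism of `𝒪_n` is determined by its values on the generators. -/
theorem hom_ext {n : ℕ} {ρ ρ' : CuntzAlgebra n →⋆ₐ[ℂ] CuntzAlgebra n}
    (h : ∀ i, ρ (S i) = ρ' (S i)) : ρ = ρ' := by
  have hc : ∀ φ : CuntzAlgebra n →⋆ₐ[ℂ] CuntzAlgebra n, Continuous φ := fun φ => map_continuous φ
  refine StarAlgHom.ext_topologicalClosure (S := StarAlgebra.adjoin ℂ (Set.range (univGen n)))
    (hc ρ) (hc ρ') ?_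
  refine StarAlgHom.ext_adjoin ?_
  rintro ⟨_, hx⟩ ⟨i, rfl⟩
  exact h i

/-- For each unitary `u` in `𝒪_n` there is exactly one unital star endomorphism of `𝒪_n` that sends
`S_i` to `u S_i` for every `i`. -/
theorem existsUnique_endo {n : ℕ} (u : unitary (CuntzAlgebra n)) :
    ∃! ρ : CuntzAlgebra n →⋆ₐ[ℂ] CuntzAlgebra n, ∀ i, ρ (S i) = (u : CuntzAlgebra n) * S i := by
  refine existsUnique_of_exists_of_unique ?_ fun ρ ρ' h h' => hom_ext fun i => by rw [h, h']
  have hu : ∀ π : Rep n, incl n u π ∈ unitary (EllTwo →L[ℂ] EllTwo) := fun π => by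
    have h := Unitary.map_mem (incl n) u.2
    exact ⟨congrArg (fun x : RepProd n => x π) h.1, congrArg (fun x : RepProd n => x π) h.2⟩
  let Φ : RepProd n →⋆ₐ[ℂ] RepProd n := reindex fun π => ⟨_, π.2.unitary_mul (hu π)⟩
  have hΦ : ∀ i, Φ (univGen n i) = incl n (u * S i) := fun i => rfl
  have hle : cuntzSubalgebra n ≤ (cuntzSubalgebra n).comap Φ := by
    refine StarSubalgebra.topologicalClosure_minimal ?_
      ((isClosed_cuntzSubalgebra n).preimage (map_continuous Φ))
    refine StarAlgebra.adjoin_le ?_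
    rintro _ ⟨i, rfl⟩
    change Φ (univGen n i) ∈ cuntzSubalgebra n
    rw [hΦ]
    exact (u * S i : CuntzAlgebra n).2
  exact ⟨(Φ.comp (incl n)).codRestrict (cuntzSubalgebra n) fun x => hle x.2,
    fun i => Subtype.ext (hΦ i)⟩

/-- The endomorphism `λ_u` of `𝒪_n`, given by `λ_u (S_i) = u S_i`. -/
def endo {n : ℕ} (u : unitary (CuntzAlgebra n)) : CuntzAlgebra n →⋆ₐ[ℂ] CuntzAlgebra n :=
  (existsUnique_endo u).choose

theorem endo_S {n : ℕ} (u : unitary (CuntzAlgebra n)) (i : Fin n) :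
    endo u (S i) = (u : CuntzAlgebra n) * S i :=
  (existsUnique_endo u).choose_spec.1 i

/-- The word `S_α = S_{α_1} ⋯ S_{α_k}` of a multi-index `α ∈ W_n^k`; it is `1` for `k = 0`. -/
def word {n k : ℕ} (α : Fin k → Fin n) : CuntzAlgebra n :=
  (List.ofFn fun j => S (α j)).prod

/-- The subalgebra `ℱ_n^k` of `𝒪_n`, as a linear subspace: the span of all `S_α S_β^*` with
`α, β ∈ W_n^k`. -/
def core (n k : ℕ) : Submodule ℂ (CuntzAlgebra n) :=
  Submodule.span ℂ {x | ∃ α β : Fin k → Fin n, x = word α * star (word β)}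

/-- The Bogolyubov automorphisms of `𝒪_n`: the `λ_z` with `z` a unitary in `ℱ_n^1`. -/
def IsBogolyubov {n : ℕ} (β : CuntzAlgebra n →⋆ₐ[ℂ] CuntzAlgebra n) : Prop :=
  ∃ z : unitary (CuntzAlgebra n), (z : CuntzAlgebra n) ∈ core n 1 ∧ β = endo z

/-- A permutation `σ` of `W_n^k` is induced if some `ω ∈ Sym(k)` satisfies
`σ(α) = (α_{ω(1)}, …, α_{ω(k)})` for all `α`. -/
def IsInduced {n k : ℕ} (σ : Equiv.Perm (Fin k → Fin n)) : Prop :=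
  ∃ ω : Equiv.Perm (Fin k), ∀ (α : Fin k → Fin n) (j : Fin k), σ α j = α (ω j)

/-- The permutation unitary `∑_α S_{σ(α)} S_α^*` of a permutation `σ` of `W_n^k`. -/
def permUnitary {n k : ℕ} (σ : Equiv.Perm (Fin k → Fin n)) : CuntzAlgebra n :=
  ∑ α : Fin k → Fin n, word (σ α) * star (word α)

end Cuntz

end

/-! The elements `S_α S_β^*` with `α, β ∈ W_n^k` are matrix units, so `u` is given by a matrix `U`
on the `k`-th tensor power of `ℂ^n`. For `z ∈ ℱ_n^1` one has `λ_u(z) = u z u^*`; comparing the two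
composites on each `S_i` gives `u z S_i` and `λ_z(u) z S_i`, so `λ_u` commutes with `λ_z` iff
`λ_z(u) = u` (`endo_comp_eq_iff`). On `ℱ_n^k`, `λ_z` is conjugation by the tensor power `Z^{⊗k}` of
the matrix of `z`. The condition is thus that `U` commutes with `Z^{⊗k}` for every unitary `Z`, and
Schur–Weyl duality (`mem_span_placePerm`) says that `U` is then a combination of place permutations,
which are the matrices of the induced permutation unitaries.

Schur–Weyl duality rests on two facts. By the double centralizer theorem for the symmetric group,
`U` need only commute with every matrix `B` invariant under simultaneous permutation of places. The
entries of `U A^{⊗k} - A^{⊗k} U` are homogeneous polynomials in `A` vanishing on unitaries, hence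
zero by Zariski density; their coefficient identities yield commutation with every such `B`. -/

noncomputable section

namespace Cuntz

/-! ### Zariski density of the unitary group, via the Cayley transform. -/

section Density

variable {m : Type*}

/-- Evaluation of a polynomial in matrix entries at a matrix. -/
def evalMatrix {R : Type*} [CommRing R] [Algebra ℂ R] (A : Matrix m m R) :
    MvPolynomial (m × m) ℂ →ₐ[ℂ] R :=
  MvPolynomial.aeval fun e => A e.1 e.2

theorem evalMatrix_smul {p : MvPolynomial (m × m) ℂ} {k : ℕ} (hp : p.IsHomogeneous k) (c : ℂ)
    (A : Matrix m m ℂ) : evalMatrix (c • A) p = c ^ k * evalMatrix A p := by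
  rw [evalMatrix, evalMatrix, MvPolynomial.aeval_def, MvPolynomial.aeval_def,
    MvPolynomial.eval₂_eq, MvPolynomial.eval₂_eq, Finset.mul_sum]
  refine Finset.sum_congr rfl fun d hd => ?_
  have hdeg : ∑ i ∈ d.support, d i = k := by
    simpa [Finsupp.weight_apply, Finsupp.sum] using hp (MvPolynomial.mem_support_iff.mp hd)
  simp only [Matrix.smul_apply, smul_eq_mul, mul_pow, Finset.prod_mul_distrib,
    Finset.prod_pow_eq_pow_sum, hdeg]
  ring

variable [Fintype m] [DecidableEq m]

theorem cayley_mem_unitaryGroup {K : Matrix m m ℂ} (hK : star K = -K) (h : (1 - K).det ≠ 0) :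
    (1 + K) * (1 - K)⁻¹ ∈ Matrix.unitaryGroup m ℂ := by
  have h1 : IsUnit (1 - K).det := isUnit_iff_ne_zero.mpr h
  have hs : star (1 - K) = 1 + K := by rw [star_sub, star_one, hK, sub_neg_eq_add]
  have h2 : IsUnit (1 + K).det := by
    rw [← hs, Matrix.star_eq_conjTranspose, Matrix.det_conjTranspose]
    exact h1.star
  have hs' : star (1 + K) = 1 - K := by rw [star_add, star_one, hK, sub_eq_add_neg]
  have hc : (1 - K) * (1 + K) = (1 + K) * (1 - K) := by noncomm_ring
  rw [Matrix.mem_unitaryGroup_iff']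
  rw [star_mul, hs', Matrix.star_eq_conjTranspose, Matrix.conjTranspose_nonsing_inv,
    ← Matrix.star_eq_conjTranspose, hs]
  calc (1 + K)⁻¹ * (1 - K) * ((1 + K) * (1 - K)⁻¹)
      = (1 + K)⁻¹ * ((1 - K) * (1 + K)) * (1 - K)⁻¹ := by simp only [mul_assoc]
    _ = ((1 + K)⁻¹ * (1 + K)) * ((1 - K) * (1 - K)⁻¹) := by rw [hc]; simp only [mul_assoc]
    _ = 1 := by rw [Matrix.nonsing_inv_mul _ h2, Matrix.mul_nonsing_inv _ h1, one_mul]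

/-- The value of a polynomial at the Cayley transform of `K`, with denominators cleared. -/
def cayleyValue {R : Type*} [CommRing R] [Algebra ℂ R] (p : MvPolynomial (m × m) ℂ)
    (K : Matrix m m R) : R :=
  evalMatrix ((1 + K) * (1 - K).adjugate) p * (1 - K).det

/-- Naturality in the coefficient ring lets a matrix over `ℂ[t]` be specialised at each complex `t`.
-/
theorem map_cayleyValue {R T : Type*} [CommRing R] [Algebra ℂ R] [CommRing T] [Algebra ℂ T]
    (f : R →ₐ[ℂ] T) (p : MvPolynomial (m × m) ℂ) (K : Matrix m m R) :
    f (cayleyValue p K) = cayleyValue p (f.mapMatrix K) := by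
  have h1 : f.mapMatrix (1 - K) = 1 - f.mapMatrix K := by rw [map_sub, map_one]
  rw [cayleyValue, cayleyValue, map_mul, ← h1, AlgHom.map_det]
  congr 1
  rw [← AlgHom.map_adjugate]
  have h2 : f.mapMatrix ((1 + K) * (1 - K).adjugate) =
      (1 + f.mapMatrix K) * f.mapMatrix (1 - K).adjugate := by rw [map_mul, map_add, map_one]
  rw [← h2]
  have : f.comp (evalMatrix ((1 + K) * (1 - K).adjugate)) =
      evalMatrix (f.mapMatrix ((1 + K) * (1 - K).adjugate)) := by
    refine MvPolynomial.algHom_ext fun e => ?_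
    simp only [evalMatrix, AlgHom.comp_apply, MvPolynomial.aeval_X, AlgHom.mapMatrix_apply,
      Matrix.map_apply]
  exact congrArg (fun g => g p) this

/-- For invertible `1 - K`, the cleared Cayley transform is `det (1 - K)` times a unitary, and
homogeneity absorbs that scalar. The trailing determinant in `cayleyValue` covers the singular case.
-/
theorem cayleyValue_eq_zero_of_skew {p : MvPolynomial (m × m) ℂ} {k : ℕ} (hp : p.IsHomogeneous k)
    (h : ∀ z ∈ Matrix.unitaryGroup m ℂ, evalMatrix z p = 0)
    {K : Matrix m m ℂ} (hK : star K = -K) : cayleyValue p K = 0 := by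
  by_cases hd : (1 - K).det = 0
  · rw [cayleyValue, hd, mul_zero]
  · have h1 := h _ (cayley_mem_unitaryGroup hK hd)
    have h2 : (1 + K) * (1 - K).adjugate = (1 - K).det • ((1 + K) * (1 - K)⁻¹) := by
      rw [Matrix.inv_def, Ring.inverse_eq_inv', mul_smul_comm, smul_smul, mul_inv_cancel₀ hd,
        one_smul]
    rw [cayleyValue, h2, evalMatrix_smul hp, h1, mul_zero, zero_mul]

/-- Every matrix is `K₁ + i K₂` with both `K`s skew-adjoint. Since `K₁ + t K₂` is skew-adjoint for
real `t`, the polynomial in `t` obtained from `cayleyValue` vanishes on the real line, hence also at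
`t = i`. -/
theorem cayleyValue_eq_zero {p : MvPolynomial (m × m) ℂ} {k : ℕ} (hp : p.IsHomogeneous k)
    (h : ∀ z ∈ Matrix.unitaryGroup m ℂ, evalMatrix z p = 0) (M : Matrix m m ℂ) :
    cayleyValue p M = 0 := by
  obtain ⟨K₁, hK₁⟩ : ∃ K₁ : Matrix m m ℂ, K₁ = (1 / 2 : ℂ) • (M - star M) := ⟨_, rfl⟩
  obtain ⟨K₂, hK₂⟩ : ∃ K₂ : Matrix m m ℂ, K₂ = (-(Complex.I / 2) : ℂ) • (M + star M) := ⟨_, rfl⟩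
  have hs₁ : star K₁ = -K₁ := by
    rw [hK₁, star_smul, star_sub, star_star, ← smul_neg, neg_sub]
    congr 1; simp
  have hs₂ : star K₂ = -K₂ := by
    rw [hK₂, star_smul, star_add, star_star, ← neg_smul, add_comm]
    congr 1; simp [neg_div]
  have hM : M = K₁ + Complex.I • K₂ := by
    rw [hK₁, hK₂, smul_smul]
    have : Complex.I * -(Complex.I / 2) = 1 / 2 := by
      linear_combination (-1 / 2 : ℂ) * Complex.I_mul_I
    rw [this, ← smul_add]
    rw [sub_add_add_cancel, ← two_smul ℂ M, smul_smul]; norm_num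
  let N : Matrix m m (Polynomial ℂ) :=
    K₁.map Polynomial.C + (Polynomial.X : Polynomial ℂ) • K₂.map Polynomial.C
  have hN : ∀ t : ℂ, (Polynomial.aeval t).mapMatrix N = K₁ + t • K₂ := fun t => by
    ext i j
    simp only [N, AlgHom.mapMatrix_apply, Matrix.map_apply, Matrix.add_apply, Matrix.smul_apply,
      smul_eq_mul, map_add, map_mul, Polynomial.aeval_X, Polynomial.aeval_C, Algebra.algebraMap_self,
      RingHom.id_apply]
  have hev : ∀ t : ℂ, (cayleyValue p N).eval t = cayleyValue p (K₁ + t • K₂) := fun t => by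
    rw [← hN, ← map_cayleyValue, Polynomial.coe_aeval_eq_eval]
  have hzero : cayleyValue p N = 0 := by
    refine Polynomial.eq_zero_of_infinite_isRoot _ ?_
    refine (Set.infinite_range_of_injective Complex.ofReal_injective).mono ?_
    rintro _ ⟨t, rfl⟩
    change Polynomial.eval _ _ = 0
    rw [hev]
    refine cayleyValue_eq_zero_of_skew hp h ?_
    rw [star_add, hs₁, star_smul, hs₂, RCLike.star_def, Complex.conj_ofReal, smul_neg, neg_add]
  rw [hM, ← hev, hzero, Polynomial.eval_zero]

/-- The unitary group is Zariski dense: a homogeneous polynomial vanishing on all unitary matrices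
is zero. -/
theorem eq_zero_of_evalMatrix_unitary {p : MvPolynomial (m × m) ℂ} {k : ℕ}
    (hp : p.IsHomogeneous k) (h : ∀ z ∈ Matrix.unitaryGroup m ℂ, evalMatrix z p = 0) :
    p = 0 := by
  have key : ∀ A : Matrix m m ℂ, evalMatrix A p * (1 + A).det = 0 := fun A => by
    by_cases hd : (1 + A).det = 0
    · rw [hd, mul_zero]
    have hu : IsUnit (1 + A).det := isUnit_iff_ne_zero.mpr hd
    set B : Matrix m m ℂ := (1 + A)⁻¹ with hB
    have hBA : B * (1 + A) = 1 := Matrix.nonsing_inv_mul _ hu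
    have hAB : (1 + A) * B = 1 := Matrix.mul_nonsing_inv _ hu
    have hAB' : A * B = 1 - B := by rw [add_mul, one_mul] at hAB; rw [← hAB]; abel
    -- Inverse Cayley transform: `K = 1 - 2(1 + A)⁻¹` gives `1 - K = 2B` and `1 + K = A(2B)`, so the
    -- cleared transform of `K` is `det(2B) A`.
    have h1 := cayleyValue_eq_zero hp h (1 - (2 : ℂ) • B)
    have e1 : (1 : Matrix m m ℂ) - (1 - (2 : ℂ) • B) = (2 : ℂ) • B := sub_sub_cancel _ _
    have e2 : (1 : Matrix m m ℂ) + (1 - (2 : ℂ) • B) = A * ((2 : ℂ) • B) := by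
      rw [mul_smul_comm, hAB', smul_sub, two_smul ℂ (1 : Matrix m m ℂ)]; abel
    have hdet : ((2 : ℂ) • B).det ≠ 0 := by
      rw [Matrix.det_smul]
      refine mul_ne_zero (pow_ne_zero _ two_ne_zero) fun h0 => ?_
      have := congrArg Matrix.det hBA
      rw [Matrix.det_mul, h0, zero_mul, Matrix.det_one] at this
      exact zero_ne_one this
    rw [cayleyValue, e1, e2, mul_assoc, Matrix.mul_adjugate, mul_smul_comm, mul_one,
      evalMatrix_smul hp] at h1
    have h2 := (mul_eq_zero.mp h1).resolve_right hdet
    rw [(mul_eq_zero.mp h2).resolve_left (pow_ne_zero _ hdet), zero_mul]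
  -- The pointwise identity becomes one in the polynomial ring, an integral domain; the determinant
  -- factor is nonzero because its value at the zero matrix is 1.
  have hprod : p * (1 + Matrix.mvPolynomialX m m ℂ).det = 0 := by
    refine MvPolynomial.funext fun x => ?_
    have := key (Matrix.of fun i j => x (i, j))
    rw [map_mul, map_zero, RingHom.map_det, map_add, map_one]
    convert this using 2
    · exact (DFunLike.congr_fun (MvPolynomial.coe_aeval_eq_eval x) p).symm
    · congr 2
      ext i j; simp
  refine (mul_eq_zero.mp hprod).resolve_right fun h0 => ?_
  have := congrArg (MvPolynomial.eval 0) h0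
  rw [RingHom.map_det, map_add, map_one, map_zero] at this
  have e : (MvPolynomial.eval (0 : m × m → ℂ)).mapMatrix (Matrix.mvPolynomialX m m ℂ) = 0 := by
    ext i j; simp
  rw [e, add_zero, Matrix.det_one] at this
  exact one_ne_zero this

end Density

/-! ### Coefficient identities and symmetric functions on words. -/

section Symmetric

/-- Equal multiplicities mean that the fibres of `w` and `w'` over each letter are equinumerous;
bijections of fibres glue to `τ`. -/
theorem exists_perm_comp_eq {ι σ : Type*} [Fintype ι] {w w' : ι → σ}
    (h : ∑ j, Finsupp.single (w j) 1 = (∑ j, Finsupp.single (w' j) 1 : σ →₀ ℕ)) :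
    ∃ τ : Equiv.Perm ι, w' ∘ τ = w := by
  classical
  have hc : ∀ c : σ, Nonempty ({a // w a = c} ≃ {b // w' b = c}) := fun c => by
    refine ⟨Fintype.equivOfCardEq ?_⟩
    have := DFunLike.congr_fun h c
    simpa [Finsupp.finsetSum_apply, Finsupp.single_apply, Fintype.card_subtype] using this
  exact ⟨Equiv.ofFiberEquiv fun c => (hc c).some, funext fun a => Equiv.ofFiberEquiv_map _ a⟩

/-- Words with the same monomial differ by a permutation of places, so `B` is constant on each such
class, while the `c w` in a class add up to a coefficient of the zero polynomial. -/
theorem sum_mul_eq_zero_of_symmetric {σ : Type*} [Fintype σ] {k : ℕ} {c : (Fin k → σ) → ℂ}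
    (h : ∑ w, MvPolynomial.C (c w) * ∏ j, MvPolynomial.X (w j) = (0 : MvPolynomial σ ℂ))
    {B : (Fin k → σ) → ℂ} (hB : ∀ (τ : Equiv.Perm (Fin k)) w, B (w ∘ τ) = B w) :
    ∑ w, c w * B w = 0 := by
  classical
  let ty : (Fin k → σ) → (σ →₀ ℕ) := fun w => ∑ j, Finsupp.single (w j) 1
  have hcoef : ∀ d, ∑ w with ty w = d, c w = 0 := fun d => by
    have := congrArg (MvPolynomial.coeff d) h
    have hX : ∀ w : Fin k → σ, (∏ j, MvPolynomial.X (w j) : MvPolynomial σ ℂ) =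
        MvPolynomial.monomial (ty w) 1 := fun w => by
      simp only [MvPolynomial.X, ty]
      rw [MvPolynomial.monomial_sum_one]
    simpa [MvPolynomial.coeff_sum, hX, MvPolynomial.coeff_C_mul, MvPolynomial.coeff_monomial,
      Finset.sum_filter] using this
  rw [← Finset.sum_fiberwise_of_maps_to (s := Finset.univ) (t := Finset.univ.image ty) (g := ty)
    fun w _ => Finset.mem_image_of_mem _ (Finset.mem_univ w)]
  refine Finset.sum_eq_zero fun d hd => ?_
  obtain ⟨w₀, -, rfl⟩ := Finset.mem_image.mp hd
  have : ∀ w ∈ Finset.univ.filter (fun w => ty w = ty w₀), c w * B w = c w * B w₀ := fun w hw => by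
    obtain ⟨τ, rfl⟩ := exists_perm_comp_eq (Finset.mem_filter.mp hw).2
    rw [hB]
  rw [Finset.sum_congr rfl this, ← Finset.sum_mul, hcoef, zero_mul]

end Symmetric

/-! ### The double centralizer theorem for finite groups. -/

section DoubleCentralizer

/-- The double centralizer theorem for a representation of a finite group. -/
theorem mem_span_range_of_commute_commutant {k G V : Type*} [Field k] [Group G] [Finite G]
    [NeZero (Nat.card G : k)] [AddCommGroup V] [Module k V] [Module.Finite k V]
    (ρ : Representation k G V) (f : Module.End k V)
    (hf : ∀ g : Module.End k V, (∀ σ, Commute g (ρ σ)) → Commute f g) :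
    f ∈ Submodule.span k (Set.range ρ) := by
  -- The hypothesis on `f` says that it is linear over the commutant of the group algebra, the form
  -- needed for Jacobson density.
  let F : Module.End (Module.End (MonoidAlgebra k G) ρ.asModule) ρ.asModule :=
    { toFun := fun x => ρ.asModuleEquiv.symm (f (ρ.asModuleEquiv x))
      map_add' := fun x y => by simp only [map_add]
      map_smul' := fun g x => by
        let g' : Module.End k V := ρ.asModuleEquiv.toLinearMap ∘ₗ
          g.restrictScalars k ∘ₗ ρ.asModuleEquiv.symm.toLinearMap
        have hg' : ∀ σ, Commute g' (ρ σ) := fun σ => by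
          ext v
          change ρ.asModuleEquiv (g (ρ.asModuleEquiv.symm (ρ σ v))) =
            ρ σ (ρ.asModuleEquiv (g (ρ.asModuleEquiv.symm v)))
          rw [Representation.asModuleEquiv_symm_map_rho, map_smul,
            Representation.asModuleEquiv_map_smul, Representation.asAlgebraHom_of]
        have := DFunLike.congr_fun (hf g' hg').eq (ρ.asModuleEquiv x)
        change f (ρ.asModuleEquiv (g x)) = ρ.asModuleEquiv (g (ρ.asModuleEquiv.symm (f _))) at this
        change ρ.asModuleEquiv.symm (f (ρ.asModuleEquiv (g x))) = _
        rw [this, LinearEquiv.symm_apply_apply]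
        rfl }
  obtain ⟨s, hs⟩ := Module.Finite.fg_top (R := k) (M := ρ.asModule)
  -- The module is semisimple by Maschke's theorem; agreement with `r` on the finite spanning set
  -- `s` is agreement everywhere.
  obtain ⟨r, hr⟩ := jacobson_density F s
  have hfr : f = ρ.asAlgebraHom r := by
    have : ρ.asModuleEquiv.symm.toLinearMap ∘ₗ f ∘ₗ ρ.asModuleEquiv.toLinearMap =
        ρ.asModuleEquiv.symm.toLinearMap ∘ₗ ρ.asAlgebraHom r ∘ₗ ρ.asModuleEquiv.toLinearMap := by
      refine LinearMap.ext_on hs fun x hx => ?_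
      have := hr x hx
      change ρ.asModuleEquiv.symm (f (ρ.asModuleEquiv x)) = _ at this
      change ρ.asModuleEquiv.symm (f (ρ.asModuleEquiv x)) =
        ρ.asModuleEquiv.symm (ρ.asAlgebraHom r (ρ.asModuleEquiv x))
      rw [this, ← Representation.asModuleEquiv_map_smul, LinearEquiv.symm_apply_apply]
    ext v
    have h2 := DFunLike.congr_fun this (ρ.asModuleEquiv.symm v)
    simpa using h2
  rw [hfr]
  clear hfr hr
  induction r using MonoidAlgebra.induction_linear with
  | zero => rw [map_zero]; exact zero_mem _
  | add a b ha hb => rw [map_add]; exact add_mem ha hb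
  | single g a =>
    rw [Representation.asAlgebraHom_single]
    exact Submodule.smul_mem _ _ (Submodule.subset_span ⟨g, rfl⟩)

end DoubleCentralizer

/-! ### Schur–Weyl duality for tensor powers. -/

section SchurWeyl

variable {m : Type*} {k : ℕ}

/-- The matrix of the `k`-th tensor power of `z`, indexed by words of length `k`. -/
def tensorPow (k : ℕ) (z : Matrix m m ℂ) : Matrix (Fin k → m) (Fin k → m) ℂ :=
  Matrix.of fun β α => ∏ j, z (β j) (α j)

theorem tensorPow_apply (z : Matrix m m ℂ) (β α : Fin k → m) :
    tensorPow k z β α = ∏ j, z (β j) (α j) := rfl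

theorem tensorPow_mul [Fintype m] (y z : Matrix m m ℂ) :
    tensorPow k (y * z) = tensorPow k y * tensorPow k z := by
  ext β α
  simp only [tensorPow_apply, Matrix.mul_apply, ← Finset.prod_mul_distrib]
  rw [Finset.prod_univ_sum, Fintype.piFinset_univ]

theorem tensorPow_one [DecidableEq m] : tensorPow k (1 : Matrix m m ℂ) = 1 := by
  ext β α
  rw [tensorPow_apply, Matrix.one_apply]
  split_ifs with h
  · subst h; simp
  · obtain ⟨j, hj⟩ := Function.ne_iff.mp h
    exact Finset.prod_eq_zero (Finset.mem_univ j) (Matrix.one_apply_ne hj)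

theorem tensorPow_star (z : Matrix m m ℂ) : tensorPow k (star z) = star (tensorPow k z) := by
  ext β α
  simp only [Matrix.star_apply, tensorPow_apply, star_prod]

/-- The permutation matrix on words of length `k` sending `α` to `α ∘ ω`. -/
def placePerm [DecidableEq m] (ω : Equiv.Perm (Fin k)) : Matrix (Fin k → m) (Fin k → m) ℂ :=
  Matrix.of fun β α => if β = α ∘ ω then 1 else 0

theorem placePerm_apply [DecidableEq m] (ω : Equiv.Perm (Fin k)) (β α : Fin k → m) :
    placePerm ω β α = if β = α ∘ ω then 1 else 0 := rfl

theorem eq_comp_perm_iff (ω : Equiv.Perm (Fin k)) (β α : Fin k → m) :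
    β = α ∘ ω ↔ α = β ∘ ω.symm := by
  constructor <;> rintro rfl <;> funext j <;> simp

theorem commute_tensorPow_placePerm [Fintype m] [DecidableEq m] (z : Matrix m m ℂ) (ω : Equiv.Perm (Fin k)) :
    Commute (tensorPow k z) (placePerm ω) := by
  ext β α
  rw [Matrix.mul_apply, Matrix.mul_apply]
  simp only [placePerm_apply, eq_comp_perm_iff ω β, mul_ite, mul_one, mul_zero, ite_mul, one_mul,
    zero_mul, Finset.sum_ite_eq', Finset.mem_univ, if_true, tensorPow_apply]
  exact (Fintype.prod_equiv ω.symm _ _ fun j => by simp).symm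

/-- The representation of the symmetric group on the tensor power by permuting places. -/
def placeRep (m : Type*) (k : ℕ) :
    Representation ℂ (Equiv.Perm (Fin k)) ((Fin k → m) → ℂ) where
  toFun ω := LinearMap.funLeft ℂ ℂ fun β => β ∘ ω
  map_one' := rfl
  map_mul' _ _ := rfl

theorem placeRep_apply (ω : Equiv.Perm (Fin k)) (v : (Fin k → m) → ℂ) (β : Fin k → m) :
    placeRep m k ω v β = v (β ∘ ω) := rfl

variable [Fintype m] [DecidableEq m]

theorem toLin'_placePerm (ω : Equiv.Perm (Fin k)) :
    Matrix.toLin' (placePerm ω : Matrix (Fin k → m) (Fin k → m) ℂ) = placeRep m k ω⁻¹ := by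
  refine LinearMap.ext fun v => funext fun β => ?_
  rw [placeRep_apply, Matrix.toLin'_apply, Matrix.mulVec, dotProduct]
  simp only [placePerm_apply, eq_comp_perm_iff ω β, ite_mul, one_mul, zero_mul]
  rw [Finset.sum_ite_eq' ]
  simp [Equiv.Perm.inv_def]

/-- Each entry of the commutator is linear in the second matrix. On tensor powers it is a
homogeneous polynomial, which density forces to be zero; its coefficients then kill every
place-invariant `B`. -/
theorem commute_of_commute_tensorPow_unitary {U : Matrix (Fin k → m) (Fin k → m) ℂ}
    (hU : ∀ z ∈ Matrix.unitaryGroup m ℂ, Commute U (tensorPow k z))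
    {B : Matrix (Fin k → m) (Fin k → m) ℂ}
    (hB : ∀ (τ : Equiv.Perm (Fin k)) α β, B (α ∘ τ) (β ∘ τ) = B α β) : Commute U B := by
  refine Matrix.ext fun γ δ => ?_
  -- Coefficients of the functional `A ↦ (U A - A U) γ δ`, a pair of words being read as one word of
  -- index pairs.
  let c : (Fin k → m × m) → ℂ := fun w =>
    (if (fun j => (w j).2) = δ then U γ fun j => (w j).1 else 0) -
      (if (fun j => (w j).1) = γ then U (fun j => (w j).2) δ else 0)
  have hc : ∀ A : Matrix (Fin k → m) (Fin k → m) ℂ,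
      ∑ w, c w * A (fun j => (w j).1) (fun j => (w j).2) = (U * A) γ δ - (A * U) γ δ := fun A => by
    rw [← Equiv.sum_comp (Equiv.arrowProdEquivProdArrow (Fin k) (fun _ => m) (fun _ => m)).symm,
      Fintype.sum_prod_type]
    simp only [c, Equiv.arrowProdEquivProdArrow, Equiv.coe_fn_symm_mk, sub_mul, ite_mul, zero_mul,
      Finset.sum_sub_distrib, Finset.sum_ite_eq', Finset.mem_univ, if_true, Matrix.mul_apply]
    congr 1
    rw [Finset.sum_comm]
    simp [mul_comm]
  let p : MvPolynomial (m × m) ℂ := ∑ w, MvPolynomial.C (c w) * ∏ j, MvPolynomial.X (w j)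
  have hp : p.IsHomogeneous k := by
    refine MvPolynomial.IsHomogeneous.sum _ _ _ fun w _ => ?_
    have h1 := (MvPolynomial.isHomogeneous_C (m × m) (c w)).mul
      (MvPolynomial.IsHomogeneous.prod Finset.univ (fun j => MvPolynomial.X (w j)) (fun _ => 1)
        fun j _ => MvPolynomial.isHomogeneous_X ℂ (w j))
    simpa using h1
  have hp0 : p = 0 := by
    refine eq_zero_of_evalMatrix_unitary hp fun z hz => ?_
    have h1 := hc (tensorPow k z)
    rw [(hU z hz).eq, sub_self] at h1
    rw [← h1]
    simp [p, evalMatrix, tensorPow_apply]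
  have h2 := sum_mul_eq_zero_of_symmetric hp0
    (B := fun w => B (fun j => (w j).1) (fun j => (w j).2)) fun τ w =>
    hB τ (fun j => (w j).1) fun j => (w j).2
  rw [hc] at h2
  exact sub_eq_zero.mp h2

/-- Schur–Weyl duality for the unitary group. -/
theorem mem_span_placePerm {U : Matrix (Fin k → m) (Fin k → m) ℂ}
    (hU : ∀ z ∈ Matrix.unitaryGroup m ℂ, Commute U (tensorPow k z)) :
    U ∈ Submodule.span ℂ (Set.range placePerm) := by
  have h := mem_span_range_of_commute_commutant (placeRep m k) (Matrix.toLin' U) fun g hg => by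
    obtain ⟨B, rfl⟩ := Matrix.toLin'.surjective g
    have : Commute U B := by
      refine commute_of_commute_tensorPow_unitary hU fun τ α β => ?_
      have h1 := congrFun (DFunLike.congr_fun (hg τ).eq (Pi.single (β ∘ τ) 1)) α
      rw [Module.End.mul_apply, Module.End.mul_apply, placeRep_apply, Matrix.toLin'_apply,
        Matrix.toLin'_apply, Matrix.mulVec_single_one] at h1
      have h2 : placeRep m k τ (Pi.single (β ∘ τ) 1) = Pi.single β 1 := by
        funext γ
        rw [placeRep_apply]
        by_cases hγ : γ = β
        · subst hγ; simp
        · rw [Pi.single_eq_of_ne hγ, Pi.single_eq_of_ne fun h => hγ ?_]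
          exact τ.surjective.injective_comp_right h
      rw [h2, Matrix.mulVec_single_one] at h1
      exact h1.symm
    rw [Commute, SemiconjBy, Module.End.mul_eq_comp, Module.End.mul_eq_comp, ← Matrix.toLin'_mul,
      ← Matrix.toLin'_mul, this.eq]
  have h' := Submodule.mem_map_of_mem (f := (Matrix.toLin' (R := ℂ)).symm.toLinearMap) h
  rw [Submodule.map_span] at h'
  change Matrix.toLin'.symm (Matrix.toLin' U) ∈ _ at h'
  rw [LinearEquiv.symm_apply_apply] at h'
  refine Submodule.span_mono ?_ h'
  rintro _ ⟨_, ⟨ω, rfl⟩, rfl⟩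
  -- The inverse appears because `placePerm` moves basis words while `placeRep` pulls back
  -- functions.
  refine ⟨ω⁻¹, ?_⟩
  change _ = Matrix.toLin'.symm (placeRep m k ω)
  rw [LinearEquiv.eq_symm_apply, toLin'_placePerm, inv_inv]

end SchurWeyl

/-! ### Matrix algebras spanned by matrix units. -/

section MatrixUnits

variable {A ι : Type*} [Ring A] [StarRing A] [Algebra ℂ A] [Fintype ι]

/-- The linear map from matrices to `A` attached to the matrix units `w a * star (w b)`. -/
def ofMatrix (w : ι → A) : Matrix ι ι ℂ →ₗ[ℂ] A where
  toFun M := ∑ a, ∑ b, M a b • (w a * star (w b))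
  map_add' M N := by simp only [Matrix.add_apply, add_smul, Finset.sum_add_distrib]
  map_smul' c M := by
    simp only [Matrix.smul_apply, smul_eq_mul, mul_smul, Finset.smul_sum, RingHom.id_apply]

theorem ofMatrix_apply (w : ι → A) (M : Matrix ι ι ℂ) :
    ofMatrix w M = ∑ a, ∑ b, M a b • (w a * star (w b)) := rfl

theorem ofMatrix_eq_sum_mul_star (w : ι → A) (M : Matrix ι ι ℂ) :
    ofMatrix w M = ∑ b, (∑ a, M a b • w a) * star (w b) := by
  rw [ofMatrix_apply, Finset.sum_comm]
  simp only [Finset.sum_mul, smul_mul_assoc]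

theorem star_ofMatrix [StarModule ℂ A] (w : ι → A) (M : Matrix ι ι ℂ) :
    star (ofMatrix w M) = ofMatrix w (star M) := by
  rw [ofMatrix_apply, ofMatrix_apply, Finset.sum_comm]
  simp only [star_sum, star_smul, star_mul, star_star, Matrix.star_apply]

theorem span_le_range_ofMatrix (w : ι → A) :
    Submodule.span ℂ {x | ∃ a b, x = w a * star (w b)} ≤ LinearMap.range (ofMatrix w) := by
  classical
  rw [Submodule.span_le]
  rintro _ ⟨a, b, rfl⟩
  refine ⟨Matrix.single a b 1, ?_⟩
  rw [ofMatrix_apply, Finset.sum_eq_single a, Finset.sum_eq_single b]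
  · rw [Matrix.single_apply_same, one_smul]
  · intro c _ hc; rw [Matrix.single_apply_of_ne _ _ _ _ _ fun h => hc h.2.symm, zero_smul]
  · exact fun h => (h (Finset.mem_univ _)).elim
  · intro c _ hc
    exact Finset.sum_eq_zero fun d _ => by
      rw [Matrix.single_apply_of_ne _ _ _ _ _ fun h => hc h.1.symm, zero_smul]
  · exact fun h => (h (Finset.mem_univ _)).elim

theorem ofMatrix_change [StarModule ℂ A] {w w' : ι → A} {Z : Matrix ι ι ℂ} (h : ∀ b, w' b = ∑ a, Z a b • w a)
    (M : Matrix ι ι ℂ) : ofMatrix w' M = ofMatrix w (Z * M * star Z) := by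
  have h1 : ∀ a b, w' a * star (w' b) =
      ∑ c, ∑ d, (Z c a * star (Z d b)) • (w c * star (w d)) := fun a b => by
    rw [h, h, star_sum, Finset.sum_mul_sum]
    simp only [star_smul, smul_mul_smul_comm]
  simp only [ofMatrix_apply, h1, Finset.smul_sum, Matrix.mul_apply, Matrix.star_apply,
    Finset.sum_smul, Finset.sum_mul, smul_smul]
  simp_rw [← Fintype.sum_prod_type']
  let e : ι × ι × ι × ι ≃ ι × ι × ι × ι :=
    ⟨fun x => (x.2.2.1, x.2.2.2, x.2.1, x.1), fun y => (y.2.2.2, y.2.2.1, y.1, y.2.1),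
      fun _ => rfl, fun _ => rfl⟩
  refine Fintype.sum_equiv e _ _ fun x => ?_
  simp only [e, Equiv.coe_fn_mk]
  congr 1
  ring

variable [DecidableEq ι]

theorem ofMatrix_mul_apply {w : ι → A} (hw : ∀ a b, star (w a) * w b = if a = b then 1 else 0)
    (M : Matrix ι ι ℂ) (b : ι) : ofMatrix w M * w b = ∑ a, M a b • w a := by
  rw [ofMatrix_eq_sum_mul_star, Finset.sum_mul]
  simp only [mul_assoc, hw, mul_ite, mul_one, mul_zero, Finset.sum_ite_eq', Finset.mem_univ,
    if_true]

theorem ofMatrix_mul {w : ι → A} (hw : ∀ a b, star (w a) * w b = if a = b then 1 else 0)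
    (M N : Matrix ι ι ℂ) : ofMatrix w (M * N) = ofMatrix w M * ofMatrix w N := by
  rw [ofMatrix_eq_sum_mul_star w N, Finset.mul_sum, ofMatrix_eq_sum_mul_star]
  refine Finset.sum_congr rfl fun b _ => ?_
  rw [← mul_assoc, Finset.mul_sum]
  congr 1
  simp only [mul_smul_comm, ofMatrix_mul_apply hw, Finset.smul_sum, smul_smul, Matrix.mul_apply,
    Finset.sum_smul]
  rw [Finset.sum_comm]
  simp only [mul_comm]

theorem ofMatrix_one (w : ι → A) : ofMatrix w 1 = ∑ a, w a * star (w a) := by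
  rw [ofMatrix_apply]
  simp only [Matrix.one_apply, ite_smul, one_smul, zero_smul, Finset.sum_ite_eq, Finset.mem_univ,
    if_true]

theorem star_mul_ofMatrix_mul {w : ι → A}
    (hw : ∀ a b, star (w a) * w b = if a = b then 1 else 0)
    (M : Matrix ι ι ℂ) (a b : ι) : star (w a) * (ofMatrix w M * w b) = M a b • 1 := by
  rw [ofMatrix_mul_apply hw, Finset.mul_sum]
  simp only [mul_smul_comm, hw, smul_ite, smul_zero, Finset.sum_ite_eq, Finset.mem_univ, if_true]

theorem ofMatrix_injective [Nontrivial A] {w : ι → A}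
    (hw : ∀ a b, star (w a) * w b = if a = b then 1 else 0) :
    Function.Injective (ofMatrix w) := fun M N h => by
  ext a b
  have h1 := star_mul_ofMatrix_mul hw M a b
  rw [h, star_mul_ofMatrix_mul hw] at h1
  exact (smul_left_injective ℂ one_ne_zero h1).symm

theorem ofMatrix_mem_unitary_iff [StarModule ℂ A] [Nontrivial A] {w : ι → A}
    (hw : ∀ a b, star (w a) * w b = if a = b then 1 else 0) (h1 : ∑ a, w a * star (w a) = 1)
    (M : Matrix ι ι ℂ) : ofMatrix w M ∈ unitary A ↔ M ∈ Matrix.unitaryGroup ι ℂ := by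
  rw [Unitary.mem_iff, Matrix.unitaryGroup, Unitary.mem_iff, star_ofMatrix, ← ofMatrix_mul hw,
    ← ofMatrix_mul hw, ← h1, ← ofMatrix_one, (ofMatrix_injective hw).eq_iff,
    (ofMatrix_injective hw).eq_iff]

end MatrixUnits

/-- Isometries whose range projections sum to one have orthogonal ranges. -/
theorem IsCuntzFamily.star_mul_eq {A : Type*} [CStarAlgebra A] {n : ℕ} {s : Fin n → A}
    (hs : IsCuntzFamily s) (i j : Fin n) : star (s i) * s j = if i = j then 1 else 0 := by
  let _ := CStarAlgebra.spectralOrder A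
  let _ := CStarAlgebra.spectralOrderedRing A
  split_ifs with h
  · rw [h, hs.1]
  -- Compressing `∑ s_l s_l^* = 1` by `s_j` gives 1, already contributed by `l = j`; the remaining
  -- positive terms sum to 0, so each vanishes.
  have hsum : ∑ l ∈ Finset.univ.erase j, star (star (s l) * s j) * (star (s l) * s j) = 0 := by
    have h1 : ∑ l, star (star (s l) * s j) * (star (s l) * s j) = 1 := by
      have : ∀ l, star (star (s l) * s j) * (star (s l) * s j) =
          star (s j) * (s l * star (s l)) * s j := fun l => by
        rw [star_mul, star_star]; simp only [mul_assoc]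
      simp only [this]
      rw [← Finset.sum_mul, ← Finset.mul_sum, hs.2, mul_one, hs.1]
    rw [← Finset.add_sum_erase _ _ (Finset.mem_univ j), hs.1, star_one, one_mul] at h1
    exact left_eq_add.mp h1.symm
  have h0 := (Finset.sum_eq_zero_iff_of_nonneg fun l _ => star_mul_self_nonneg _).mp hsum i
    (Finset.mem_erase.mpr ⟨h, Finset.mem_univ i⟩)
  exact CStarRing.star_mul_self_eq_zero_iff _ |>.mp h0

/-! ### Words in the generators and the action of Bogolyubov automorphisms. -/

section Words

variable {n k : ℕ}

theorem star_S_mul_S (i j : Fin n) :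
    star (S i : CuntzAlgebra n) * S j = if i = j then 1 else 0 :=
  (isCuntzFamily_S n).star_mul_eq i j

theorem word_zero (α : Fin 0 → Fin n) : word α = 1 := by
  rw [word, List.ofFn_zero, List.prod_nil]

theorem word_succ (α : Fin (k + 1) → Fin n) :
    word α = S (α 0) * word (fun j => α j.succ) := by
  rw [word, List.ofFn_succ, List.prod_cons, word]

theorem word_one (α : Fin 1 → Fin n) : word α = S (α 0) := by
  rw [word_succ, word_zero, mul_one]

theorem star_word_mul_word (α β : Fin k → Fin n) :
    star (word α) * word β = if α = β then 1 else 0 := by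
  induction k with
  | zero => rw [word_zero, word_zero, star_one, mul_one, if_pos (Subsingleton.elim _ _)]
  | succ k ih =>
    have h : α = β ↔ α 0 = β 0 ∧ (fun j => α (Fin.succ j)) = fun j => β (Fin.succ j) := by
      rw [funext_iff, Fin.forall_fin_succ, funext_iff]
    rw [word_succ, word_succ β, star_mul, mul_assoc, ← mul_assoc (star (S _)), star_S_mul_S]
    by_cases h0 : α 0 = β 0
    · rw [if_pos h0, one_mul, ih]
      simp only [h, h0, true_and]
    · rw [if_neg h0, zero_mul, mul_zero, if_neg fun h' => h0 (h.mp h').1]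

theorem core_le_range_ofMatrix (n k : ℕ) :
    core n k ≤ LinearMap.range (ofMatrix (word : (Fin k → Fin n) → CuntzAlgebra n)) :=
  span_le_range_ofMatrix _

theorem ofMatrix_S_mem_core_one (Z : Matrix (Fin n) (Fin n) ℂ) :
    ofMatrix (S : Fin n → CuntzAlgebra n) Z ∈ core n 1 := by
  rw [ofMatrix_apply]
  refine sum_mem fun i _ => sum_mem fun j _ => Submodule.smul_mem _ _ (Submodule.subset_span ?_)
  exact ⟨fun _ => i, fun _ => j, by rw [word_one, word_one]⟩

theorem exists_ofMatrix_S_eq {z : CuntzAlgebra n} (hz : z ∈ core n 1) :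
    ∃ Z : Matrix (Fin n) (Fin n) ℂ, ofMatrix S Z = z := by
  refine span_le_range_ofMatrix S ((Submodule.span_mono ?_) hz)
  rintro _ ⟨α, β, rfl⟩
  exact ⟨α 0, β 0, by rw [word_one, word_one]⟩

theorem endo_word {z : unitary (CuntzAlgebra n)} {Z : Matrix (Fin n) (Fin n) ℂ}
    (hz : ofMatrix S Z = (z : CuntzAlgebra n)) (α : Fin k → Fin n) :
    endo z (word α) = ∑ β, tensorPow k Z β α • word β := by
  induction k with
  | zero =>
    rw [word_zero, map_one, Fintype.sum_unique, word_zero, tensorPow_apply, Fin.prod_univ_zero,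
      one_smul]
  | succ k ih =>
    rw [word_succ, map_mul, endo_S, ih, ← hz, ofMatrix_mul_apply star_S_mul_S, Finset.sum_mul_sum,
      ← Fintype.sum_prod_type',
      ← Equiv.sum_comp (Fin.consEquiv fun _ : Fin (k + 1) => Fin n)]
    refine Finset.sum_congr rfl fun x _ => ?_
    rw [smul_mul_smul_comm, word_succ, tensorPow_apply, tensorPow_apply, Fin.prod_univ_succ]
    simp [Fin.consEquiv]

theorem map_ofMatrix (ρ : CuntzAlgebra n →⋆ₐ[ℂ] CuntzAlgebra n) {ι : Type*} [Fintype ι]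
    (w : ι → CuntzAlgebra n) (M : Matrix ι ι ℂ) :
    ρ (ofMatrix w M) = ofMatrix (fun a => ρ (w a)) M := by
  simp only [ofMatrix_apply, map_sum, map_smul, map_mul, map_star]

theorem endo_ofMatrix_word {z : unitary (CuntzAlgebra n)} {Z : Matrix (Fin n) (Fin n) ℂ}
    (hz : ofMatrix S Z = (z : CuntzAlgebra n)) (U : Matrix (Fin k → Fin n) (Fin k → Fin n) ℂ) :
    endo z (ofMatrix word U) = ofMatrix word (tensorPow k Z * U * star (tensorPow k Z)) := by
  rw [map_ofMatrix]
  exact ofMatrix_change (endo_word hz) U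

theorem endo_apply_of_mem_core_one (u : unitary (CuntzAlgebra n)) {z : CuntzAlgebra n}
    (hz : z ∈ core n 1) : endo u z = u * z * star (u : CuntzAlgebra n) := by
  obtain ⟨Z, rfl⟩ := exists_ofMatrix_S_eq hz
  rw [map_ofMatrix]
  simp only [ofMatrix_apply, endo_S, star_mul, Finset.mul_sum, Finset.sum_mul, mul_smul_comm,
    smul_mul_assoc, mul_assoc]

theorem eq_of_forall_mul_S_eq {x y : CuntzAlgebra n} (h : ∀ i, x * S i = y * S i) : x = y := by
  have hx : ∀ x : CuntzAlgebra n, x = ∑ i, x * S i * star (S i) := fun x => by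
    simp only [mul_assoc]
    rw [← Finset.mul_sum, (isCuntzFamily_S n).2, mul_one]
  rw [hx x, hx y]
  simp only [h]

/-- `λ_u` commutes with the Bogolyubov automorphism `λ_z` exactly when `λ_z` fixes `u`. -/
theorem endo_comp_eq_iff (u : unitary (CuntzAlgebra n)) {z : unitary (CuntzAlgebra n)}
    (hz : (z : CuntzAlgebra n) ∈ core n 1) :
    (endo u).comp (endo z) = (endo z).comp (endo u) ↔ endo z u = (u : CuntzAlgebra n) := by
  have h1 : ∀ i, (endo u).comp (endo z) (S i) = u * z * S i := fun i => by
    rw [StarAlgHom.comp_apply, endo_S, map_mul, endo_apply_of_mem_core_one u hz, endo_S, mul_assoc,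
      ← mul_assoc (star (u : CuntzAlgebra n)), Unitary.coe_star_mul_self, one_mul]
  have h2 : ∀ i, (endo z).comp (endo u) (S i) = endo z u * z * S i := fun i => by
    rw [StarAlgHom.comp_apply, endo_S, map_mul, endo_S, mul_assoc]
  constructor
  · intro h
    have h3 : (u : CuntzAlgebra n) * z = endo z u * z := eq_of_forall_mul_S_eq fun i => by
      rw [← h1, ← h2, h]
    have h4 := congrArg (· * star (z : CuntzAlgebra n)) h3
    rw [mul_assoc, mul_assoc, Unitary.mul_star_self_of_mem z.2, mul_one, mul_one] at h4
    exact h4.symm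
  · intro h
    exact hom_ext fun i => by rw [h1, h2, h]

/-- On `ℱ_n^k` the map `λ_z` is conjugation by the unitary `Z^{⊗k}`, so fixed points are the
matrices commuting with it. -/
theorem endo_ofMatrix_word_eq_iff [Nontrivial (CuntzAlgebra n)] {z : unitary (CuntzAlgebra n)}
    {Z : Matrix (Fin n) (Fin n) ℂ} (hz : ofMatrix S Z = (z : CuntzAlgebra n))
    (U : Matrix (Fin k → Fin n) (Fin k → Fin n) ℂ) :
    endo z (ofMatrix word U) = ofMatrix word U ↔ Commute U (tensorPow k Z) := by
  have hZ : Z ∈ Matrix.unitaryGroup (Fin n) ℂ :=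
    (ofMatrix_mem_unitary_iff star_S_mul_S (isCuntzFamily_S n).2 Z).mp (hz ▸ z.2)
  have h1 : star (tensorPow k Z) * tensorPow k Z = 1 := by
    rw [← tensorPow_star, ← tensorPow_mul, Matrix.mem_unitaryGroup_iff'.mp hZ, tensorPow_one]
  have h2 : tensorPow k Z * star (tensorPow k Z) = 1 := by
    rw [← tensorPow_star, ← tensorPow_mul, Matrix.mem_unitaryGroup_iff.mp hZ, tensorPow_one]
  rw [endo_ofMatrix_word hz, (ofMatrix_injective star_word_mul_word).eq_iff]
  constructor
  · intro h
    rw [Commute, SemiconjBy]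
    nth_rewrite 1 [← h]
    rw [mul_assoc, h1, mul_one]
  · intro h
    rw [← h.eq, mul_assoc, h2, mul_one]

theorem permUnitary_eq_ofMatrix {σ : Equiv.Perm (Fin k → Fin n)} {ω : Equiv.Perm (Fin k)}
    (h : ∀ α, σ α = α ∘ ω) : permUnitary σ = ofMatrix word (placePerm ω) := by
  rw [permUnitary, ofMatrix_eq_sum_mul_star]
  refine Finset.sum_congr rfl fun α _ => ?_
  simp only [placePerm_apply, ite_smul, one_smul, zero_smul, Finset.sum_ite_eq', Finset.mem_univ,
    if_true, h]

theorem setOf_induced_permUnitary_eq (n k : ℕ) :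
    {x : CuntzAlgebra n | ∃ σ : Equiv.Perm (Fin k → Fin n), IsInduced σ ∧ x = permUnitary σ} =
      ofMatrix (word (k := k)) '' Set.range placePerm := by
  ext x
  constructor
  · rintro ⟨σ, ⟨ω, hω⟩, rfl⟩
    exact ⟨_, ⟨ω, rfl⟩, (permUnitary_eq_ofMatrix fun α => funext (hω α)).symm⟩
  · rintro ⟨_, ⟨ω, rfl⟩, rfl⟩
    exact ⟨ω.symm.arrowCongr (Equiv.refl _), ⟨ω, fun α j => rfl⟩,
      (permUnitary_eq_ofMatrix fun α => rfl).symm⟩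

end Words

end Cuntz

end

/-! ### The commutation criterion. -/

theorem lemma5p3 (n k : ℕ) (hn : 2 ≤ n) (u : unitary (Cuntz.CuntzAlgebra n))
    (hu : (u : Cuntz.CuntzAlgebra n) ∈ Cuntz.core n k) :
    (∀ β : Cuntz.CuntzAlgebra n →⋆ₐ[ℂ] Cuntz.CuntzAlgebra n, Cuntz.IsBogolyubov β →
        (Cuntz.endo u).comp β = β.comp (Cuntz.endo u)) ↔
      (u : Cuntz.CuntzAlgebra n) ∈ Submodule.span ℂ
        {x | ∃ σ : Equiv.Perm (Fin k → Fin n), Cuntz.IsInduced σ ∧ x = Cuntz.permUnitary σ} := by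
  open Cuntz in
  -- Injectivity of `ofMatrix` needs `1 ≠ 0`; in the zero algebra both sides hold trivially.
  rcases subsingleton_or_nontrivial (CuntzAlgebra n) with h0 | h0
  · refine iff_of_true (fun β _ => hom_ext fun i => Subsingleton.elim _ _) ?_
    rw [Subsingleton.elim (u : CuntzAlgebra n) 0]
    exact zero_mem _
  obtain ⟨U, hU⟩ := core_le_range_ofMatrix n k hu
  rw [setOf_induced_permUnitary_eq, ← Submodule.map_span, ← hU]
  constructor
  · intro h
    refine Submodule.mem_map_of_mem (mem_span_placePerm fun Z hZ => ?_)
    let z : unitary (CuntzAlgebra n) :=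
      ⟨ofMatrix S Z, (ofMatrix_mem_unitary_iff star_S_mul_S (isCuntzFamily_S n).2 Z).mpr hZ⟩
    have hz : (z : CuntzAlgebra n) ∈ core n 1 := ofMatrix_S_mem_core_one Z
    have h1 := (endo_comp_eq_iff u hz).mp (h _ ⟨z, hz, rfl⟩)
    rw [← hU] at h1
    exact (endo_ofMatrix_word_eq_iff (z := z) rfl U).mp h1
  · rintro h _ ⟨z, hz, rfl⟩
    rw [endo_comp_eq_iff u hz, ← hU]
    obtain ⟨Z, hZ⟩ := exists_ofMatrix_S_eq hz
    rw [endo_ofMatrix_word_eq_iff hZ]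
    obtain ⟨V, hV, hVU⟩ := h
    rw [ofMatrix_injective star_word_mul_word hVU] at hV
    -- `U` is now known to lie in the span of place permutations, and commuting with `Z^{⊗k}` is a
    -- linear condition, so span induction applies.
    clear hVU hU
    induction hV using Submodule.span_induction with
    | mem _ hx => obtain ⟨ω, rfl⟩ := hx; exact (commute_tensorPow_placePerm Z ω).symm
    | zero => exact Commute.zero_left _
    | add _ _ _ _ ha hb => exact ha.add_left hb
    | smul c _ _ ha => exact ha.smul_left c
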